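/- Fix a field $\mathbb F$; all chains and homology have coefficients in $\mathbb F$. Let $T$ be a totally ordered set with least element $0$, let $X$ be a set, and let $\mathcal X^T=(\mathcal X^t)_{t\in T}$ be a filtered simplicial complex with vertex set $X$: each $\mathcal X^t$ is a simplicial complex having every point of $X$ as a vertex, and $\mathcal X^s\subseteq\mathcal X^t$ for $s\le t$. For $V\subseteq X$ let $\mathcal X^t(V)$ be the subcomplex of all simplices of $\mathcal X^t$ whose vertices lie in $V$. Let $\mathcal U$ be a cover of $X$ by subsets. The cover complex $\mathcal X^T(\mathcal U)$ is given by $\mathcal X^t(\mathcal U)=\bigcup_{U\in\mathcal U}\mathcal X^t(U)$. Let $\overline{\mathcal U}$ be the set of all intersections of nonempty subfamilies of $\mathcal U$, and let the nerve $\mathcal N(\mathcal U)$ be the simplicial complex whose simplices are the nonempty finite subfamilies of $\mathcal U$ with nonempty intersection. A simplicial complex is acyclic if its reduced homology $\tilde H_q$ vanishes for all $q\ge 0$. Let $\alpha:T\to T$ be non-decreasing, and suppose that for every $V\in\overline{\mathcal U}$ the filtered complex $\mathcal X^T(V)$ is $\alpha$-acyclic: for all $t\in T$ and $q\ge 0$,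 every reduced $q$-cycle of $\mathcal X^t(V)$ (for $q=0$: every $0$-chain with coefficient sum $0$) is the boundary of a $(q+1)$-chain of $\mathcal X^{\alpha(t)}(V)$. If $\mathcal N(\mathcal U)$ is acyclic, then for every $k\ge 0$ the reduced persistent homology $\tilde H_k(\mathcal X^T(\mathcal U))$ is $\alpha^{k+1}$-acyclic, where $\alpha^{k+1}$ is the $(k+1)$-fold iterate of $\alpha$. That is, for all $t,s\in T$ with $s\ge t$ and $s\ge\alpha^{k+1}(t)$, the map $$\tilde H_k(\mathcal X^t(\mathcal U))\to\tilde H_k(\mathcal X^s(\mathcal U))$$ induced by inclusion is zero; in particular every bar alive at $t$ dies by $\alpha^{k+1}(t)$ whenever $\alpha^{k+1}(t)\ge t$. -/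

import Mathlib

noncomputable section

namespace CoverComplex

/-! ### Subquotients of a module -/

section Subquotient

variable {R M : Type*} [Ring R] [AddCommGroup M] [Module R M]

/-- The subquotient `Z / (B ∩ Z)` of a module. -/
abbrev Subquotient (Z B : Submodule R M) : Type _ :=
  ↥Z ⧸ B.submoduleOf Z

/-- The map `Z / (B ∩ Z) → Z' / (B' ∩ Z')` induced by inclusions `Z ⊆ Z'` and `B ⊆ B'`. -/
def Subquotient.map {Z B Z' B' : Submodule R M} (hZ : Z ≤ Z') (hB : B ≤ B') :
    Subquotient Z B →ₗ[R] Subquotient Z' B' :=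
  Submodule.mapQ _ _ (Submodule.inclusion hZ) (fun _ hz => hB hz)

end Subquotient

/-! ### Reduced simplicial homology of an abstract simplicial complex -/

section Homology

variable (𝕜 : Type*) [Field 𝕜] {V : Type*}

open scoped Classical in
/-- The position of the vertex `v` in the simplex `σ`, when the vertices of `σ` are listed
increasingly for a fixed well-order of the vertex type (used only to orient simplices). -/
def position (σ : Finset V) (v : V) : ℕ :=
  (σ.filter fun w => WellOrderingRel w v).card

open scoped Classical in
/-- The augmented simplicial boundary
`∂ [v₀ < ⋯ < v_q] = ∑ᵢ (-1)ⁱ [v₀, …, v̂ᵢ, …, v_q]`, on formal combinations of finite sets.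
The empty set is the generator in degree `-1`, so on `0`-chains `∂` is the augmentation. -/
def boundary : (Finset V →₀ 𝕜) →ₗ[𝕜] (Finset V →₀ 𝕜) :=
  Finsupp.linearCombination 𝕜 fun σ =>
    ∑ v ∈ σ, Finsupp.single (σ.erase v) ((-1 : 𝕜) ^ position σ v)

/-- The `q`-chains of `K`: combinations of the simplices of `K` with `q + 1` vertices. -/
def chains (K : PreAbstractSimplicialComplex V) (q : ℕ) : Submodule 𝕜 (Finset V →₀ 𝕜) :=
  Finsupp.supported 𝕜 𝕜 {σ | σ ∈ K.faces ∧ σ.card = q + 1}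

/-- The reduced `q`-cycles of `K`; for `q = 0` these are the `0`-chains of augmentation zero. -/
def cycles (K : PreAbstractSimplicialComplex V) (q : ℕ) : Submodule 𝕜 (Finset V →₀ 𝕜) :=
  chains 𝕜 K q ⊓ LinearMap.ker (boundary 𝕜)

/-- The `q`-boundaries of `K`. -/
def boundaries (K : PreAbstractSimplicialComplex V) (q : ℕ) : Submodule 𝕜 (Finset V →₀ 𝕜) :=
  (chains 𝕜 K (q + 1)).map (boundary 𝕜)

lemma boundary_single (σ : Finset V) (c : 𝕜) [DecidableEq V] :
    boundary 𝕜 (Finsupp.single σ c) =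
      ∑ v ∈ σ, Finsupp.single (σ.erase v) (c * (-1 : 𝕜) ^ position σ v) := by
  classical
  simp only [boundary, Finsupp.linearCombination_single, Finset.smul_sum, Finsupp.smul_single,
    smul_eq_mul]
  refine Finset.sum_congr rfl fun v _ => ?_
  congr 2
  exact Subsingleton.elim _ _

lemma position_erase_of_rel {σ : Finset V} {v w : V} [DecidableEq V] (hv : v ∈ σ)
    (h : WellOrderingRel v w) : position σ w = position (σ.erase v) w + 1 := by
  classical
  unfold position
  rw [Finset.filter_erase, Finset.card_erase_of_mem (by simp [hv, h])]
  have : 0 < (σ.filter fun u => WellOrderingRel u w).card :=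
    Finset.card_pos.mpr ⟨v, by simp [hv, h]⟩
  omega

lemma position_erase_of_not_rel {σ : Finset V} {v w : V} [DecidableEq V]
    (h : ¬ WellOrderingRel v w) : position (σ.erase v) w = position σ w := by
  classical
  unfold position
  rw [Finset.filter_erase, Finset.erase_eq_of_notMem (by simp [h])]

lemma sign_swap {σ : Finset V} {v w : V} [DecidableEq V] (hv : v ∈ σ) (hw : w ∈ σ)
    (h : v ≠ w) :
    (-1 : 𝕜) ^ position σ v * (-1 : 𝕜) ^ position (σ.erase v) w +
      (-1 : 𝕜) ^ position σ w * (-1 : 𝕜) ^ position (σ.erase w) v = 0 := by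
  have key : ∀ a b : V, a ∈ σ → WellOrderingRel a b →
      (-1 : 𝕜) ^ position σ a * (-1 : 𝕜) ^ position (σ.erase a) b +
      (-1 : 𝕜) ^ position σ b * (-1 : 𝕜) ^ position (σ.erase b) a = 0 := by
    intro a b ha hab
    rw [position_erase_of_rel ha hab, position_erase_of_not_rel (asymm hab), pow_succ]
    ring
  rcases trichotomous_of WellOrderingRel v w with h1 | h1 | h1
  · exact key v w hv h1
  · exact absurd h1 h
  · rw [add_comm]
    exact key w v hw h1

/-- `∂ ∘ ∂ = 0`. -/
lemma boundary_boundary (c : Finset V →₀ 𝕜) : boundary 𝕜 (boundary 𝕜 c) = 0 := by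
  classical
  induction c using Finsupp.induction_linear with
  | zero => simp
  | add f g hf hg => simp [hf, hg]
  | single σ c =>
    simp only [boundary_single, map_sum]
    rw [Finset.sum_sigma']
    refine Finset.sum_involution (fun p _ => ⟨p.2, p.1⟩) ?_ ?_ ?_ ?_
    · rintro ⟨v, w⟩ h
      simp only [Finset.mem_sigma, Finset.mem_erase] at h
      rw [Finset.erase_right_comm, ← Finsupp.single_add, mul_assoc, mul_assoc, ← mul_add,
        sign_swap 𝕜 h.1 h.2.2 (Ne.symm h.2.1), mul_zero, Finsupp.single_zero]
    · rintro ⟨v, w⟩ h _ heq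
      simp only [Finset.mem_sigma, Finset.mem_erase] at h
      simp only [Sigma.mk.injEq] at heq
      exact h.2.1 heq.1
    · rintro ⟨v, w⟩ h
      simp only [Finset.mem_sigma, Finset.mem_erase] at h ⊢
      exact ⟨h.2.2, Ne.symm h.2.1, h.1⟩
    · rintro ⟨v, w⟩ _
      rfl

/-- The boundary of a `(q + 1)`-chain of `K` is a `q`-cycle of `K`. -/
lemma boundaries_le_cycles (K : PreAbstractSimplicialComplex V) (q : ℕ) :
    boundaries 𝕜 K q ≤ cycles 𝕜 K q := by
  classical
  rintro _ ⟨c, hc, rfl⟩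
  refine ⟨?_, boundary_boundary 𝕜 c⟩
  have : chains 𝕜 K (q + 1) ≤ (chains 𝕜 K q).comap (boundary 𝕜) := by
    unfold chains
    rw [Finsupp.supported_eq_span_single, Submodule.span_le]
    rintro _ ⟨σ, ⟨hσ, hcard⟩, rfl⟩
    simp only [Submodule.comap_coe, Set.mem_preimage, SetLike.mem_coe, boundary_single]
    refine Submodule.sum_mem _ fun v hv => Finsupp.single_mem_supported 𝕜 _ ?_
    have h1 : (σ.erase v).card = q + 1 := by rw [Finset.card_erase_of_mem hv, hcard]; rfl
    exact ⟨(K.isRelLowerSet_faces hσ).2 (Finset.erase_subset v σ)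
      (Finset.card_pos.mp (by omega)), h1⟩
  exact this hc

lemma chains_mono {K L : PreAbstractSimplicialComplex V} (h : K ≤ L) (q : ℕ) :
    chains 𝕜 K q ≤ chains 𝕜 L q :=
  Finsupp.supported_mono fun _ hσ => ⟨h hσ.1, hσ.2⟩

lemma cycles_mono {K L : PreAbstractSimplicialComplex V} (h : K ≤ L) (q : ℕ) :
    cycles 𝕜 K q ≤ cycles 𝕜 L q :=
  inf_le_inf_right _ (chains_mono 𝕜 h q)

lemma boundaries_mono {K L : PreAbstractSimplicialComplex V} (h : K ≤ L) (q : ℕ) :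
    boundaries 𝕜 K q ≤ boundaries 𝕜 L q :=
  Submodule.map_mono (chains_mono 𝕜 h (q + 1))

/-- The reduced simplicial homology `H̃_q(K; 𝕜)`: reduced cycles modulo boundaries. -/
abbrev ReducedHomology (K : PreAbstractSimplicialComplex V) (q : ℕ) : Type _ :=
  Subquotient (cycles 𝕜 K q) (boundaries 𝕜 K q)

/-- The map `H̃_q(K; 𝕜) → H̃_q(L; 𝕜)` induced by an inclusion `K ⊆ L`. -/
def reducedHomologyMap {K L : PreAbstractSimplicialComplex V} (h : K ≤ L) (q : ℕ) :
    ReducedHomology 𝕜 K q →ₗ[𝕜] ReducedHomology 𝕜 L q :=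
  Subquotient.map (cycles_mono 𝕜 h q) (boundaries_mono 𝕜 h q)

/-- `K` is acyclic over `𝕜`: its reduced homology vanishes in all degrees `q ≥ 0`. -/
def IsAcyclic (K : PreAbstractSimplicialComplex V) : Prop :=
  ∀ q : ℕ, Subsingleton (ReducedHomology 𝕜 K q)

variable {T : Type*} [LinearOrder T]

/-- A filtered complex `F` is `α`-acyclic if every (reduced) cycle of `F t` is the boundary of a
chain of `F (α t)`. -/
def IsShiftAcyclic (F : T →o PreAbstractSimplicialComplex V) (α : T → T) : Prop :=
  ∀ (t : T) (q : ℕ), ∀ z ∈ cycles 𝕜 (F t) q, z ∈ boundaries 𝕜 (F (α t)) q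

/-- The persistent (reduced) homology `H̃_q(F)` is `β`-acyclic: a class present at parameter `t`
has zero image at every later parameter `s ≥ β t`, so a bar alive at `t` is dead by `β t`.
If `t ≤ β t`, this says that the structure map from `t` to `β t` is zero. -/
def HomologyIsShiftAcyclic (F : T →o PreAbstractSimplicialComplex V) (q : ℕ) (β : T → T) : Prop :=
  ∀ (t s : T) (hts : t ≤ s), β t ≤ s → reducedHomologyMap 𝕜 (F.monotone hts) q = 0

end Homology

/-! ### Covers, nerves and cover complexes -/

section Covers

variable {X : Type*}

/-- The refinement of `𝒰`: all intersections of nonempty subfamilies of `𝒰`. -/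
def refinement (𝒰 : Set (Set X)) : Set (Set X) :=
  {V | ∃ 𝒮 : Set (Set X), 𝒮 ⊆ 𝒰 ∧ 𝒮.Nonempty ∧ V = ⋂₀ 𝒮}

/-- The nerve of `𝒰`: its simplices are the nonempty finite subfamilies of `𝒰` with nonempty
intersection. -/
def nerve (𝒰 : Set (Set X)) : PreAbstractSimplicialComplex (Set X) where
  faces := {σ | σ.Nonempty ∧ (σ : Set (Set X)) ⊆ 𝒰 ∧ (⋂₀ (σ : Set (Set X))).Nonempty}
  isRelLowerSet_faces := fun _ hσ => ⟨hσ.1, fun _ hτσ hτ =>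
    ⟨hτ, (Finset.coe_subset.mpr hτσ).trans hσ.2.1,
      hσ.2.2.mono (Set.sInter_subset_sInter (Finset.coe_subset.mpr hτσ))⟩⟩

variable {T : Type*} [LinearOrder T]

/-- `K(V)`: the simplices of the filtered complex `K` all of whose vertices lie in `V`. -/
def restrict (K : T →o AbstractSimplicialComplex X) (V : Set X) :
    T →o PreAbstractSimplicialComplex X where
  toFun t :=
    { faces := {σ | σ ∈ (K t).faces ∧ (σ : Set X) ⊆ V}
      isRelLowerSet_faces := fun _ hσ =>
        ⟨((K t).isRelLowerSet_faces hσ.1).1, fun _ hτσ hτ =>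
          ⟨((K t).isRelLowerSet_faces hσ.1).2 hτσ hτ,
            (Finset.coe_subset.mpr hτσ).trans hσ.2⟩⟩ }
  monotone' := fun _ _ hst _ hσ => ⟨K.monotone hst hσ.1, hσ.2⟩

/-- The cover complex `K(𝒰)`: the simplices of `K` whose vertices all lie in a common member
of `𝒰`. -/
def coverComplex (K : T →o AbstractSimplicialComplex X) (𝒰 : Set (Set X)) :
    T →o PreAbstractSimplicialComplex X where
  toFun t :=
    { faces := {σ | σ ∈ (K t).faces ∧ ∃ U ∈ 𝒰, (σ : Set X) ⊆ U}
      isRelLowerSet_faces := fun _ hσ =>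
        ⟨((K t).isRelLowerSet_faces hσ.1).1, fun _ hτσ hτ =>
          ⟨((K t).isRelLowerSet_faces hσ.1).2 hτσ hτ,
            hσ.2.imp fun _ hU => ⟨hU.1, (Finset.coe_subset.mpr hτσ).trans hU.2⟩⟩⟩ }
  monotone' := fun _ _ hst _ hσ => ⟨K.monotone hst hσ.1, hσ.2⟩

end Covers

end CoverComplex

end

noncomputable section

namespace CoverComplex

/-! ### Fibrewise linear maps on formal combinations of pairs -/

section Fibres

variable {𝕜 A B : Type*} [Field 𝕜]

/-! The proof is a staircase in the augmented Mayer–Vietoris double complex. Its generators are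
pairs (σ, τ) with σ ⊆ 𝒰 finite and τ a simplex inside ⋂ σ, either entry possibly empty. Column σ = ∅
is the cover complex, row τ = ∅ is the nerve.

Rows over τ ≠ ∅ are exact because a member of 𝒰 containing τ serves as a cone apex
(`exists_onCofibres_boundary_eq`). The row over ∅ is exact because the nerve is acyclic. Columns
over σ ≠ ∅ are exact up to one application of α (`exists_onFibres_boundary_eq`), and at τ = ∅
without any shift.

A k-cycle sits in bidegree (0, k+1), counting vertices. Lifting along rows and taking boundaries
along columns leads to (k+1, 0), where the nerve gives the last lift. Each of the k+1 steps back
costs one α (`exists_double_boundary_eq`). -/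

/-- The formal combination of the second entries of the pairs with first entry `a`. -/
def fibre (a : A) : (A × B →₀ 𝕜) →ₗ[𝕜] (B →₀ 𝕜) :=
  Finsupp.lapply a ∘ₗ (Finsupp.curryLinearEquiv 𝕜).toLinearMap

@[simp]
lemma fibre_apply (a : A) (c : A × B →₀ 𝕜) (b : B) : fibre a c b = c (a, b) := by
  simp [fibre]

lemma fibre_ext {c c' : A × B →₀ 𝕜} (h : ∀ a, fibre a c = fibre a c') : c = c' := by
  ext ⟨a, b⟩
  simpa using DFunLike.congr_fun (h a) b

/-- The map applying `L` to each fibre. -/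
def onFibres (L : (B →₀ 𝕜) →ₗ[𝕜] (B →₀ 𝕜)) : (A × B →₀ 𝕜) →ₗ[𝕜] (A × B →₀ 𝕜) :=
  (Finsupp.curryLinearEquiv 𝕜).symm.toLinearMap ∘ₗ Finsupp.mapRange.linearMap L ∘ₗ
    (Finsupp.curryLinearEquiv 𝕜).toLinearMap

@[simp]
lemma fibre_onFibres (L : (B →₀ 𝕜) →ₗ[𝕜] (B →₀ 𝕜)) (a : A) (c : A × B →₀ 𝕜) :
    fibre a (onFibres L c) = L (fibre a c) := by
  simp [fibre, onFibres]

/-- Fibrewise solutions of `L e = c` assemble to a global one. -/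
lemma exists_onFibres_eq (L : (B →₀ 𝕜) →ₗ[𝕜] (B →₀ 𝕜)) (E : A → Submodule 𝕜 (B →₀ 𝕜))
    (c : A × B →₀ 𝕜) (h : ∀ a, fibre a c ≠ 0 → ∃ e ∈ E a, L e = fibre a c) :
    ∃ e : A × B →₀ 𝕜, onFibres L e = c ∧ ∀ a, fibre a e ∈ E a := by
  classical
  -- Choosing 0 over zero fibres keeps the assembled family finitely supported.
  have h' : ∀ a, ∃ e ∈ E a, L e = fibre a c ∧ (fibre a c = 0 → e = 0) := by
    intro a
    by_cases h0 : fibre a c = 0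
    · exact ⟨0, zero_mem _, by simp [h0], fun _ => rfl⟩
    · obtain ⟨e, he, hL⟩ := h a h0
      exact ⟨e, he, hL, fun h1 => absurd h1 h0⟩
  choose e he hL h0 using h'
  let f : A →₀ (B →₀ 𝕜) := Finsupp.onFinset (Finsupp.curryLinearEquiv 𝕜 c).support e
    fun a ha => by
      rw [Finsupp.mem_support_iff]
      exact fun h => ha (h0 a h)
  have hf : ∀ a, fibre a ((Finsupp.curryLinearEquiv 𝕜).symm f) = e a := fun a => by
    simp [fibre, f]
  refine ⟨(Finsupp.curryLinearEquiv 𝕜).symm f, fibre_ext fun a => ?_, fun a => ?_⟩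
  · rw [fibre_onFibres, hf, hL]
  · rw [hf]
    exact he a

/-- Exchange of the entries of pairs. -/
def swap : (A × B →₀ 𝕜) ≃ₗ[𝕜] (B × A →₀ 𝕜) :=
  Finsupp.domLCongr (Equiv.prodComm A B)

@[simp]
lemma swap_apply (c : A × B →₀ 𝕜) (x : B × A) : swap c x = c (x.2, x.1) := by
  simp [swap, Finsupp.domLCongr_apply, Prod.swap]

lemma swap_swap (c : A × B →₀ 𝕜) : swap (swap c) = c := by
  ext; simp

/-- The product of two formal combinations. -/
def pairing (f : A →₀ 𝕜) (g : B →₀ 𝕜) : A × B →₀ 𝕜 :=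
  Finsupp.onFinset (f.support ×ˢ g.support) (fun x => f x.1 * g x.2) fun x hx => by
    simpa using hx

@[simp]
lemma pairing_apply (f : A →₀ 𝕜) (g : B →₀ 𝕜) (x : A × B) :
    pairing f g x = f x.1 * g x.2 := rfl

lemma onFibres_pairing (L : (B →₀ 𝕜) →ₗ[𝕜] (B →₀ 𝕜)) (f : A →₀ 𝕜) (g : B →₀ 𝕜) :
    onFibres L (pairing f g) = pairing f (L g) := by
  refine fibre_ext fun a => ?_
  have h : ∀ g : B →₀ 𝕜, fibre a (pairing f g) = f a • g := fun g => by ext; simp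
  rw [fibre_onFibres, h, h, map_smul]

lemma swap_pairing (f : A →₀ 𝕜) (g : B →₀ 𝕜) : swap (pairing f g) = pairing g f := by
  ext; simp [mul_comm]

/-- The map applying `M` to each fibre over a second entry. -/
def onCofibres (M : (A →₀ 𝕜) →ₗ[𝕜] (A →₀ 𝕜)) : (A × B →₀ 𝕜) →ₗ[𝕜] (A × B →₀ 𝕜) :=
  swap.toLinearMap ∘ₗ onFibres M ∘ₗ swap.toLinearMap

lemma onCofibres_apply (M : (A →₀ 𝕜) →ₗ[𝕜] (A →₀ 𝕜)) (c : A × B →₀ 𝕜) :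
    onCofibres M c = swap (onFibres M (swap c)) := rfl

/-- By linearity it suffices to treat pure products, where the two maps act on different factors. No
signs are introduced, so the two differentials commute rather than anticommute. -/
lemma onCofibres_onFibres (L : (B →₀ 𝕜) →ₗ[𝕜] (B →₀ 𝕜)) (M : (A →₀ 𝕜) →ₗ[𝕜] (A →₀ 𝕜))
    (c : A × B →₀ 𝕜) :
    onCofibres M (onFibres L c) = onFibres L (onCofibres M c) := by
  classical
  induction c using Finsupp.induction_linear with
  | zero => simp
  | add f g hf hg => simp [hf, hg]
  | single x r =>
    have h : Finsupp.single x r = pairing (Finsupp.single x.1 r) (Finsupp.single x.2 (1 : 𝕜)) := by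
      ext y
      simp only [pairing_apply, Finsupp.single_apply, Prod.ext_iff]
      split_ifs <;> simp_all
    simp only [h, onCofibres_apply, onFibres_pairing, swap_pairing]

end Fibres

/-! ### Cones -/

section Cone

variable (𝕜 : Type*) [Field 𝕜] {V : Type*}

open scoped Classical in
/-- The cone operator with apex `v` on augmented simplicial chains. -/
def cone (v : V) : (Finset V →₀ 𝕜) →ₗ[𝕜] (Finset V →₀ 𝕜) :=
  Finsupp.linearCombination 𝕜 fun σ =>
    if v ∈ σ then 0 else Finsupp.single (insert v σ) ((-1 : 𝕜) ^ position (insert v σ) v)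

lemma cone_single_of_mem {v : V} {σ : Finset V} (h : v ∈ σ) (r : 𝕜) :
    cone 𝕜 v (Finsupp.single σ r) = 0 := by
  simp [cone, h]

lemma cone_single_of_notMem [DecidableEq V] {v : V} {σ : Finset V} (h : v ∉ σ) (r : 𝕜) :
    cone 𝕜 v (Finsupp.single σ r) =
      Finsupp.single (insert v σ) (r * (-1 : 𝕜) ^ position (insert v σ) v) := by
  simp only [cone, Finsupp.linearCombination_single, h, if_false, Finsupp.smul_single, smul_eq_mul]
  congr!

lemma neg_one_pow_mul_neg_one_pow (n : ℕ) : (-1 : 𝕜) ^ n * (-1 : 𝕜) ^ n = 1 := by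
  rw [← mul_pow]; simp

/-- The cone operator is a contracting homotopy. -/
lemma boundary_cone_add (v : V) (c : Finset V →₀ 𝕜) :
    boundary 𝕜 (cone 𝕜 v c) + cone 𝕜 v (boundary 𝕜 c) = c := by
  classical
  induction c using Finsupp.induction_linear with
  | zero => simp
  | add f g hf hg =>
    simp only [map_add]
    rw [add_add_add_comm, hf, hg]
  | single σ r =>
    by_cases h : v ∈ σ
    · rw [cone_single_of_mem 𝕜 h, map_zero, zero_add, boundary_single, map_sum,
        Finset.sum_eq_single_of_mem v h, cone_single_of_notMem 𝕜 (Finset.notMem_erase v σ),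
        Finset.insert_erase h, mul_assoc, neg_one_pow_mul_neg_one_pow, mul_one]
      intro w _ hw
      exact cone_single_of_mem 𝕜 (Finset.mem_erase.mpr ⟨hw.symm, h⟩) _
    · rw [cone_single_of_notMem 𝕜 h, boundary_single, boundary_single,
        Finset.sum_insert h, Finset.erase_insert h, mul_assoc, neg_one_pow_mul_neg_one_pow, mul_one,
        add_assoc, map_sum, ← Finset.sum_add_distrib, Finset.sum_eq_zero, add_zero]
      intro w hw
      have hvw : v ≠ w := fun e => h (e ▸ hw)
      have h1 : insert v (σ.erase w) = (insert v σ).erase w :=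
        (Finset.erase_insert_of_ne hvw).symm
      have h2 : σ.erase w = ((insert v σ).erase v).erase w := by rw [Finset.erase_insert h]
      have h3 := sign_swap 𝕜 (Finset.mem_insert_self v σ) (Finset.mem_insert_of_mem hw) hvw
      rw [Finset.erase_insert h] at h3
      rw [cone_single_of_notMem 𝕜 (by simp [h]), h1, ← Finsupp.single_add]
      -- Signs are their own inverses, so multiplying `h3` by two of them gives the required
      -- cancellation.
      have hA := neg_one_pow_mul_neg_one_pow 𝕜 (position σ w)
      have hW := neg_one_pow_mul_neg_one_pow 𝕜 (position (insert v σ) w)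
      rw [Finsupp.single_eq_zero]
      generalize (-1 : 𝕜) ^ position (insert v σ) v = P at *
      generalize (-1 : 𝕜) ^ position (insert v σ) w = W at *
      generalize (-1 : 𝕜) ^ position σ w = A at *
      generalize (-1 : 𝕜) ^ position ((insert v σ).erase w) v = Y at *
      linear_combination r * W * A * h3 - r * P * W * hA - r * A * Y * hW

/-- A cycle supported on the faces of a full simplex containing `v` is a boundary. -/
lemma exists_boundary_eq_of_cone {S S' : Set (Finset V)} [DecidableEq V] (v : V)
    (hS : ∀ σ ∈ S, v ∉ σ → insert v σ ∈ S') {c : Finset V →₀ 𝕜}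
    (hc : c ∈ Finsupp.supported 𝕜 𝕜 S) (hb : boundary 𝕜 c = 0) :
    ∃ e ∈ Finsupp.supported 𝕜 𝕜 S', boundary 𝕜 e = c := by
  refine ⟨cone 𝕜 v c, ?_, by simpa [hb] using boundary_cone_add 𝕜 v c⟩
  have : Finsupp.supported 𝕜 𝕜 S ≤ (Finsupp.supported 𝕜 𝕜 S').comap (cone 𝕜 v) := by
    rw [Finsupp.supported_eq_span_single, Submodule.span_le]
    rintro _ ⟨σ, hσ, rfl⟩
    simp only [Submodule.comap_coe, Set.mem_preimage, SetLike.mem_coe]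
    by_cases h : v ∈ σ
    · simp [cone_single_of_mem 𝕜 h]
    · rw [cone_single_of_notMem 𝕜 h]
      exact Finsupp.single_mem_supported 𝕜 _ (hS σ hσ h)
  exact this hc

lemma boundary_mem_supported {S S' : Set (Finset V)} [DecidableEq V]
    (hS : ∀ σ ∈ S, ∀ v ∈ σ, σ.erase v ∈ S') {c : Finset V →₀ 𝕜}
    (hc : c ∈ Finsupp.supported 𝕜 𝕜 S) : boundary 𝕜 c ∈ Finsupp.supported 𝕜 𝕜 S' := by
  have : Finsupp.supported 𝕜 𝕜 S ≤ (Finsupp.supported 𝕜 𝕜 S').comap (boundary 𝕜) := by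
    rw [Finsupp.supported_eq_span_single, Submodule.span_le]
    rintro _ ⟨σ, hσ, rfl⟩
    simp only [Submodule.comap_coe, Set.mem_preimage, SetLike.mem_coe, boundary_single]
    exact Submodule.sum_mem _ fun v hv => Finsupp.single_mem_supported 𝕜 _ (hS σ hσ v hv)
  exact this hc

end Cone

/-! ### The augmented Mayer–Vietoris double complex -/

section DoubleComplex

variable (𝕜 : Type*) [Field 𝕜] {X : Type*} {T : Type*} [LinearOrder T]
  (K : T →o AbstractSimplicialComplex X) (𝒰 : Set (Set X))

/-- The pairs of a `p`-element subfamily `σ` of `𝒰` with nonempty intersection and a `q`-element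
set `τ` in `⋂₀ σ`, small with respect to `𝒰`, which is empty or a simplex of `K t`. -/
def bisimplices (t : T) (p q : ℕ) : Set (Finset (Set X) × Finset X) :=
  {x | (x.1 : Set (Set X)) ⊆ 𝒰 ∧ x.1.card = p ∧ (⋂₀ (x.1 : Set (Set X))).Nonempty ∧
    (x.2 = ∅ ∨ x.2 ∈ (K t).faces) ∧ x.2.card = q ∧ (x.2 : Set X) ⊆ ⋂₀ (x.1 : Set (Set X)) ∧
    ∃ U ∈ 𝒰, (x.2 : Set X) ⊆ U}

/-- The augmented double complex of the cover; the bidegree counts vertices. -/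
def bichains (t : T) (p q : ℕ) : Submodule 𝕜 (Finset (Set X) × Finset X →₀ 𝕜) :=
  Finsupp.supported 𝕜 𝕜 (bisimplices K 𝒰 t p q)

variable {K 𝒰 𝕜}

lemma mem_bichains_iff_fibre {t : T} {p q : ℕ} {c : Finset (Set X) × Finset X →₀ 𝕜} :
    c ∈ bichains 𝕜 K 𝒰 t p q ↔
      ∀ σ, fibre σ c ∈ Finsupp.supported 𝕜 𝕜 {τ | (σ, τ) ∈ bisimplices K 𝒰 t p q} := by
  simp only [bichains, Finsupp.mem_supported']
  exact ⟨fun h σ τ hτ => by simpa using h _ hτ, fun h x hx => by simpa using h x.1 x.2 hx⟩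

lemma mem_bichains_iff_fibre_swap {t : T} {p q : ℕ} {c : Finset (Set X) × Finset X →₀ 𝕜} :
    c ∈ bichains 𝕜 K 𝒰 t p q ↔
      ∀ τ, fibre τ (swap c) ∈ Finsupp.supported 𝕜 𝕜 {σ | (σ, τ) ∈ bisimplices K 𝒰 t p q} := by
  simp only [bichains, Finsupp.mem_supported']
  exact ⟨fun h τ σ hσ => by simpa using h _ hσ, fun h x hx => by simpa using h x.2 x.1 hx⟩

lemma bichains_mono {s t : T} (h : s ≤ t) (p q : ℕ) :
    bichains 𝕜 K 𝒰 s p q ≤ bichains 𝕜 K 𝒰 t p q :=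
  Finsupp.supported_mono fun _ ⟨h1, h2, h3, h4, h5⟩ =>
    ⟨h1, h2, h3, h4.imp_right fun h' => K.monotone h h', h5⟩

lemma onFibres_boundary_mem {t : T} {p q : ℕ} {c : Finset (Set X) × Finset X →₀ 𝕜}
    (hc : c ∈ bichains 𝕜 K 𝒰 t p (q + 1)) :
    onFibres (boundary 𝕜) c ∈ bichains 𝕜 K 𝒰 t p q := by
  classical
  rw [mem_bichains_iff_fibre] at hc ⊢
  intro σ
  rw [fibre_onFibres]
  refine boundary_mem_supported 𝕜 ?_ (hc σ)
  rintro τ ⟨h1, h2, h3, h4, h5, h6, U, hU, h7⟩ v hv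
  have hsub : ((τ.erase v : Finset X) : Set X) ⊆ τ := Finset.coe_subset.mpr (Finset.erase_subset v τ)
  refine ⟨h1, h2, h3, ?_, ?_, hsub.trans h6, U, hU, hsub.trans h7⟩
  · rcases Finset.eq_empty_or_nonempty (τ.erase v) with h | h
    · exact Or.inl h
    · refine Or.inr (((K t).isRelLowerSet_faces (h4.resolve_left ?_)).2 (Finset.erase_subset v τ) h)
      exact Finset.ne_empty_of_mem hv
  · have h5 : τ.card = q + 1 := h5
    simp [Finset.card_erase_of_mem hv, h5]

lemma onCofibres_boundary_mem {t : T} {p q : ℕ} {c : Finset (Set X) × Finset X →₀ 𝕜}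
    (hc : c ∈ bichains 𝕜 K 𝒰 t (p + 1) q) :
    onCofibres (boundary 𝕜) c ∈ bichains 𝕜 K 𝒰 t p q := by
  classical
  rw [mem_bichains_iff_fibre_swap] at hc ⊢
  intro τ
  rw [onCofibres_apply, swap_swap, fibre_onFibres]
  refine boundary_mem_supported 𝕜 ?_ (hc τ)
  rintro σ ⟨h1, h2, h3, h4, h5, h6, h7⟩ v hv
  have hsub : ((σ.erase v : Finset (Set X)) : Set (Set X)) ⊆ σ :=
    Finset.coe_subset.mpr (Finset.erase_subset v σ)
  have h2 : σ.card = p + 1 := h2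
  exact ⟨hsub.trans h1, by simp [Finset.card_erase_of_mem hv, h2],
    h3.mono (Set.sInter_subset_sInter hsub), h4, h5,
    Set.Subset.trans h6 (Set.sInter_subset_sInter hsub), h7⟩

/-! ### Exactness of rows and columns -/

/-- The rows over nonempty simplices of the cover complex are exact. -/
lemma exists_onCofibres_boundary_eq {t : T} {p q : ℕ} {c : Finset (Set X) × Finset X →₀ 𝕜}
    (hc : c ∈ bichains 𝕜 K 𝒰 t p (q + 1)) (hb : onCofibres (boundary 𝕜) c = 0) :
    ∃ e ∈ bichains 𝕜 K 𝒰 t (p + 1) (q + 1), onCofibres (boundary 𝕜) e = c := by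
  classical
  rw [mem_bichains_iff_fibre_swap] at hc
  have hb' : ∀ τ, boundary 𝕜 (fibre τ (swap c)) = 0 := fun τ => by
    rw [← fibre_onFibres, ← swap_swap (onFibres _ _), ← onCofibres_apply, hb]
    simp
  obtain ⟨e, he, hmem⟩ := exists_onFibres_eq (boundary 𝕜)
    (fun τ => Finsupp.supported 𝕜 𝕜 {σ | (σ, τ) ∈ bisimplices K 𝒰 t (p + 1) (q + 1)}) (swap c)
    fun τ hτ => by
      obtain ⟨σ₀, hσ₀⟩ := Finsupp.support_nonempty_iff.mpr hτ
      obtain ⟨-, -, -, -, hcard, -, U, hU, hτU⟩ := hc τ hσ₀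
      -- One apex U ⊇ τ works for the whole fibre over τ: adding U to σ keeps τ inside the
      -- intersection, which is nonempty because τ is.
      refine exists_boundary_eq_of_cone 𝕜 U ?_ (hc τ) (hb' τ)
      rintro σ ⟨h1, h2, h3, h4, h5, h6, h7⟩ hUσ
      have h8 : (τ : Set X) ⊆ ⋂₀ ((insert U σ : Finset (Set X)) : Set (Set X)) := by
        rw [Finset.coe_insert, Set.sInter_insert]
        exact Set.subset_inter hτU h6
      have hne : τ.Nonempty := Finset.card_pos.mp (by simp only at hcard; omega)
      refine ⟨?_, ?_, (Finset.coe_nonempty.mpr hne).mono h8, h4, h5, h8, h7⟩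
      · simpa [Set.insert_subset_iff] using ⟨hU, h1⟩
      · simpa [Finset.card_insert_of_notMem hUσ] using h2
  refine ⟨swap e, mem_bichains_iff_fibre_swap.mpr fun τ => ?_, ?_⟩
  · rw [swap_swap]
    exact hmem τ
  · rw [onCofibres_apply, swap_swap, he, swap_swap]

lemma boundary_eq_of_isAcyclic {V : Type*} {N : PreAbstractSimplicialComplex V}
    (h : IsAcyclic 𝕜 N) {q : ℕ} {z : Finset V →₀ 𝕜} (hz : z ∈ cycles 𝕜 N q) :
    ∃ e ∈ chains 𝕜 N (q + 1), boundary 𝕜 e = z := by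
  have := h q
  have h0 : (Submodule.Quotient.mk ⟨z, hz⟩ : ReducedHomology 𝕜 N q) = 0 := Subsingleton.elim _ _
  exact (Submodule.Quotient.mk_eq_zero _).mp h0

/-- The row over the empty simplex is exact in positive degrees if the nerve is acyclic. -/
lemma exists_onCofibres_boundary_eq_of_nerve (hnerve : IsAcyclic 𝕜 (nerve 𝒰)) {t : T} {p : ℕ}
    {c : Finset (Set X) × Finset X →₀ 𝕜} (hc : c ∈ bichains 𝕜 K 𝒰 t (p + 1) 0)
    (hb : onCofibres (boundary 𝕜) c = 0) :
    ∃ e ∈ bichains 𝕜 K 𝒰 t (p + 2) 0, onCofibres (boundary 𝕜) e = c := by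
  rw [mem_bichains_iff_fibre_swap] at hc
  have hb' : ∀ τ, boundary 𝕜 (fibre τ (swap c)) = 0 := fun τ => by
    rw [← fibre_onFibres, ← swap_swap (onFibres _ _), ← onCofibres_apply, hb]
    simp
  obtain ⟨e, he, hmem⟩ := exists_onFibres_eq (boundary 𝕜)
    (fun τ => Finsupp.supported 𝕜 𝕜 {σ | (σ, τ) ∈ bisimplices K 𝒰 t (p + 2) 0}) (swap c)
    fun τ hτ => by
      obtain ⟨σ₀, hσ₀⟩ := Finsupp.support_nonempty_iff.mpr hτ
      obtain ⟨-, -, -, h4, h5, -, h7⟩ := hc τ hσ₀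
      obtain rfl : τ = ∅ := Finset.card_eq_zero.mp h5
      obtain ⟨e, he, heq⟩ := boundary_eq_of_isAcyclic hnerve (q := p)
        (z := fibre ∅ (swap c)) ⟨fun σ hσ => by
          obtain ⟨h1, h2, h3, -⟩ := hc ∅ hσ
          exact ⟨⟨Finset.card_pos.mp (by simp only at h2; omega), h1, h3⟩, h2⟩, hb' ∅⟩
      refine ⟨e, fun σ hσ => ?_, heq⟩
      obtain ⟨⟨-, h1, h3⟩, h2⟩ := he hσ
      exact ⟨h1, h2, h3, h4, h5, by simp, h7⟩
  refine ⟨swap e, mem_bichains_iff_fibre_swap.mpr fun τ => ?_, ?_⟩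
  · rw [swap_swap]
    exact hmem τ
  · rw [onCofibres_apply, swap_swap, he, swap_swap]

/-- The columns over simplices of the nerve are exact up to a shift. -/
lemma exists_onFibres_boundary_eq {α : T → T}
    (hlocal : ∀ V ∈ refinement 𝒰, IsShiftAcyclic 𝕜 (restrict K V) α)
    {t : T} {p q : ℕ} {c : Finset (Set X) × Finset X →₀ 𝕜}
    (hc : c ∈ bichains 𝕜 K 𝒰 t (p + 1) (q + 1)) (hb : onFibres (boundary 𝕜) c = 0) :
    ∃ e ∈ bichains 𝕜 K 𝒰 (α t) (p + 1) (q + 2), onFibres (boundary 𝕜) e = c := by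
  rw [mem_bichains_iff_fibre] at hc
  have hb' : ∀ σ, boundary 𝕜 (fibre σ c) = 0 := fun σ => by
    rw [← fibre_onFibres, hb, map_zero]
  obtain ⟨e, he, hmem⟩ := exists_onFibres_eq (boundary 𝕜)
    (fun σ => Finsupp.supported 𝕜 𝕜 {τ | (σ, τ) ∈ bisimplices K 𝒰 (α t) (p + 1) (q + 2)}) c
    fun σ hσ => by
      obtain ⟨τ₀, hτ₀⟩ := Finsupp.support_nonempty_iff.mpr hσ
      obtain ⟨h1, h2, h3, -⟩ := hc σ hτ₀
      -- Since σ has p + 1 members, ⋂ σ lies in the refinement and local acyclicity applies.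
      have hne : σ.Nonempty := Finset.card_pos.mp (by simp only at h2; omega)
      obtain ⟨e, he, heq⟩ := hlocal (⋂₀ (σ : Set (Set X))) ⟨σ, h1, hne, rfl⟩ t q (fibre σ c)
        ⟨fun τ hτ => by
          obtain ⟨-, -, -, h4, h5, h6, -⟩ := hc σ hτ
          refine ⟨⟨h4.resolve_left ?_, h6⟩, h5⟩
          rintro rfl
          simp at h5, hb' σ⟩
      refine ⟨e, fun τ hτ => ?_, heq⟩
      obtain ⟨⟨h4, h6⟩, h5⟩ := he hτ
      obtain ⟨U, hU⟩ := hne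
      exact ⟨h1, h2, h3, Or.inr h4, h5, h6, U, h1 hU, Set.Subset.trans h6 (Set.sInter_subset_of_mem hU)⟩
  exact ⟨e, mem_bichains_iff_fibre.mpr hmem, he⟩

/-- Every simplex of the nerve has a vertex of `K t` in its intersection. -/
lemma exists_onFibres_boundary_eq_zero {t : T} {p : ℕ} {c : Finset (Set X) × Finset X →₀ 𝕜}
    (hc : c ∈ bichains 𝕜 K 𝒰 t (p + 1) 0) :
    ∃ e ∈ bichains 𝕜 K 𝒰 t (p + 1) 1, onFibres (boundary 𝕜) e = c := by
  classical
  rw [mem_bichains_iff_fibre] at hc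
  obtain ⟨e, he, hmem⟩ := exists_onFibres_eq (boundary 𝕜)
    (fun σ => Finsupp.supported 𝕜 𝕜 {τ | (σ, τ) ∈ bisimplices K 𝒰 t (p + 1) 1}) c
    fun σ hσ => by
      obtain ⟨τ₀, hτ₀⟩ := Finsupp.support_nonempty_iff.mpr hσ
      obtain ⟨h1, h2, ⟨x, hx⟩, -⟩ := hc σ hτ₀
      obtain ⟨U, hU⟩ : σ.Nonempty := Finset.card_pos.mp (by simp only at h2; omega)
      -- The apex is any point of ⋂ σ. It is a vertex at every parameter, so no shift is needed.
      refine exists_boundary_eq_of_cone 𝕜 x ?_ (hc σ) ?_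
      · rintro τ ⟨-, -, -, -, h5, -⟩ -
        obtain rfl : τ = ∅ := Finset.card_eq_zero.mp h5
        refine ⟨h1, h2, ⟨x, hx⟩, Or.inr ?_, by simp, by simpa using hx, U, h1 hU, ?_⟩
        · simpa using (K t).singleton_mem x
        · simpa using hx U hU
      · have h0 : fibre σ c = Finsupp.single ∅ (fibre σ c ∅) := by
          refine Finsupp.support_subset_singleton.mp fun τ hτ => ?_
          obtain ⟨-, -, -, -, h5, -⟩ := hc σ hτ
          exact Finset.mem_singleton.mpr (Finset.card_eq_zero.mp h5)
        rw [h0, boundary_single, Finset.sum_empty]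
  exact ⟨e, mem_bichains_iff_fibre.mpr hmem, he⟩

/-! ### The staircase -/

lemma onFibres_boundary_boundary (c : Finset (Set X) × Finset X →₀ 𝕜) :
    onFibres (boundary 𝕜) (onFibres (boundary 𝕜) c) = 0 :=
  fibre_ext fun σ => by simp [boundary_boundary]

lemma onCofibres_boundary_boundary (c : Finset (Set X) × Finset X →₀ 𝕜) :
    onCofibres (boundary 𝕜) (onCofibres (boundary 𝕜) c) = 0 := by
  have h : onFibres (boundary 𝕜) (onFibres (boundary 𝕜) (swap c)) = 0 :=
    fibre_ext fun σ => by simp [boundary_boundary]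
  rw [onCofibres_apply, onCofibres_apply, swap_swap, h, map_zero]

/-- A bichain closed for both differentials is a double boundary after shifting. -/
lemma exists_double_boundary_eq {α : T → T} (hle : ∀ t, t ≤ α t)
    (hlocal : ∀ V ∈ refinement 𝒰, IsShiftAcyclic 𝕜 (restrict K V) α)
    (hnerve : IsAcyclic 𝕜 (nerve 𝒰)) (t : T) (n p : ℕ) (hpn : 0 < p + n)
    {c : Finset (Set X) × Finset X →₀ 𝕜} (hc : c ∈ bichains 𝕜 K 𝒰 t p n)
    (hN : onCofibres (boundary 𝕜) c = 0) (hX : onFibres (boundary 𝕜) c = 0) :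
    ∃ w ∈ bichains 𝕜 K 𝒰 (α^[n] t) (p + 1) (n + 1),
      onFibres (boundary 𝕜) (onCofibres (boundary 𝕜) w) = c := by
  induction n generalizing p c with
  | zero =>
    -- Bidegree (0, 0) is excluded: acyclicity of the nerve fills only chains with at least one
    -- vertex in σ.
    obtain ⟨p, rfl⟩ : ∃ p', p = p' + 1 := ⟨p - 1, by omega⟩
    obtain ⟨e, he, rfl⟩ := exists_onCofibres_boundary_eq_of_nerve hnerve hc hN
    obtain ⟨w, hw, rfl⟩ := exists_onFibres_boundary_eq_zero he
    exact ⟨w, hw, (onCofibres_onFibres _ _ _).symm⟩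
  | succ n ih =>
    obtain ⟨e, he, rfl⟩ := exists_onCofibres_boundary_eq hc hN
    -- The column boundary of e is again closed both ways, one step down the staircase.
    obtain ⟨w, hw, hwe⟩ := ih (p + 1) (by omega) (onFibres_boundary_mem he)
      (by rw [onCofibres_onFibres, hX]) (onFibres_boundary_boundary e)
    have ht : t ≤ α^[n] t := Function.id_le_iterate_of_id_le hle n t
    -- Correcting e by the row boundary of w makes it a column cycle without changing its row
    -- boundary. Filling it costs the one extra α of this step.
    obtain ⟨w', hw', hwe'⟩ := exists_onFibres_boundary_eq hlocal
      (c := e - onCofibres (boundary 𝕜) w)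
      (sub_mem (bichains_mono ht _ _ he) (onCofibres_boundary_mem hw))
      (by rw [map_sub, hwe, sub_self])
    refine ⟨w', ?_, ?_⟩
    · rw [Function.iterate_succ_apply']
      exact hw'
    · rw [← onCofibres_onFibres, hwe', map_sub, onCofibres_boundary_boundary, sub_zero]

/-- A cycle of the cover complex bounds after shifting `q + 1` times. -/
lemma mem_boundaries_coverComplex {α : T → T} (hle : ∀ t, t ≤ α t)
    (hlocal : ∀ V ∈ refinement 𝒰, IsShiftAcyclic 𝕜 (restrict K V) α)
    (hnerve : IsAcyclic 𝕜 (nerve 𝒰)) (t : T) (q : ℕ) {z : Finset X →₀ 𝕜}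
    (hz : z ∈ cycles 𝕜 (coverComplex K 𝒰 t) q) :
    z ∈ boundaries 𝕜 (coverComplex K 𝒰 (α^[q + 1] t)) q := by
  classical
  obtain ⟨hzc, hzb⟩ := hz
  let c : Finset (Set X) × Finset X →₀ 𝕜 := pairing (Finsupp.single ∅ 1) z
  have hc : c ∈ bichains 𝕜 K 𝒰 t 0 (q + 1) := by
    rintro ⟨σ, τ⟩ hx
    have hx : Finsupp.single (∅ : Finset (Set X)) (1 : 𝕜) σ * z τ ≠ 0 := by
      simpa [c] using hx
    obtain ⟨hσ, hτ⟩ := mul_ne_zero_iff.mp hx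
    obtain rfl : σ = ∅ := by
      by_contra h
      exact hσ (by simp [Ne.symm h])
    obtain ⟨⟨h4, h7⟩, h5⟩ := hzc (Finsupp.mem_support_iff.mpr hτ)
    obtain ⟨x, -⟩ : τ.Nonempty := Finset.card_pos.mp (by omega)
    exact ⟨by simp, rfl, ⟨x, by simp⟩, Or.inr h4, h5, by simp, h7⟩
  have hN : onCofibres (boundary 𝕜) c = 0 := by
    rw [onCofibres_apply, swap_pairing, onFibres_pairing, boundary_single, Finset.sum_empty]
    ext; simp
  have hX : onFibres (boundary 𝕜) c = 0 := by
    rw [onFibres_pairing, LinearMap.mem_ker.mp hzb]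
    ext; simp
  obtain ⟨w, hw, hwc⟩ := exists_double_boundary_eq hle hlocal hnerve t (q + 1) 0 (by omega) hc hN hX
  -- The fibre over ∅ returns to the column of the cover complex, where the double boundary becomes
  -- an ordinary one.
  refine ⟨fibre ∅ (onCofibres (boundary 𝕜) w), ?_, ?_⟩
  · intro τ hτ
    obtain ⟨-, -, -, h4, h5, -, h7⟩ :=
      mem_bichains_iff_fibre.mp (onCofibres_boundary_mem hw) ∅ hτ
    refine ⟨⟨h4.resolve_left ?_, h7⟩, h5⟩
    rintro rfl
    simp at h5
  · rw [← fibre_onFibres, hwc]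
    ext τ
    simp [c]

/-- If t ≤ α t, monotonicity makes the α-orbit of t increase, so the maximum is always α. Otherwise
t is fixed by the modified map. -/
lemma iterate_max_le {α : T → T} (hα : Monotone α) (n : ℕ) (t : T) :
    (fun x => max x (α x))^[n] t ≤ max t (α^[n] t) := by
  rcases le_total t (α t) with h | h
  · suffices hs : (fun x => max x (α x))^[n] t = α^[n] t by rw [hs]; exact le_max_right _ _
    induction n with
    | zero => rfl
    | succ n ih =>
      rw [Function.iterate_succ_apply', Function.iterate_succ_apply', ih, max_eq_right]
      rw [← Function.iterate_succ_apply' α, Function.iterate_succ_apply]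
      exact hα.iterate n h
  · rw [Function.iterate_fixed (f := fun x => max x (α x)) (max_eq_left h)]
    exact le_max_left _ _

end DoubleComplex

end CoverComplex

end

theorem mainTheorem10 {𝕜 : Type*} [Field 𝕜] {X : Type*}
    {T : Type*} [LinearOrder T] [OrderBot T]
    (K : T →o AbstractSimplicialComplex X)
    (𝒰 : Set (Set X)) (h𝒰 : ⋃₀ 𝒰 = Set.univ)
    (α : T → T) (hα : Monotone α)
    (hlocal : ∀ V ∈ CoverComplex.refinement 𝒰,
      CoverComplex.IsShiftAcyclic 𝕜 (CoverComplex.restrict K V) α)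
    (hnerve : CoverComplex.IsAcyclic 𝕜 (CoverComplex.nerve 𝒰))
    (k : ℕ) :
    CoverComplex.HomologyIsShiftAcyclic 𝕜 (CoverComplex.coverComplex K 𝒰) k (α^[k + 1]) := by
  intro t s hts hs
  refine LinearMap.ext fun x => ?_
  obtain ⟨⟨z, hz⟩, rfl⟩ := Submodule.Quotient.mk_surjective _ x
  refine (Submodule.Quotient.mk_eq_zero _).mpr ?_
  -- The staircase needs t ≤ α t, which is not assumed. Replacing α by its maximum with the identity
  -- preserves local acyclicity, and s still dominates the resulting iterate.
  have h := CoverComplex.mem_boundaries_coverComplex (α := fun x => max x (α x))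
    (fun t => le_max_left _ _)
    (fun V hV t q z hz => CoverComplex.boundaries_mono 𝕜
      ((CoverComplex.restrict K V).monotone (le_max_right t (α t))) q (hlocal V hV t q z hz))
    hnerve t k hz
  exact CoverComplex.boundaries_mono 𝕜 ((CoverComplex.coverComplex K 𝒰).monotone
    ((CoverComplex.iterate_max_le hα (k + 1) t).trans (max_le hts hs))) k h
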